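/- **Theorem (WilsonReject is unbiased).** Let $G$ be a weighted dependency graph with $n$ words: its nodes are $0,1,\dots,n$, where $0$ is ROOT and $1,\dots,n$ are the words; its edges are all $v\to u$ with $u\neq 0$ and $v\ne u$; and every edge $e=(v\to u)$ has a real weight $\phi(e)=W(v\to u)\ge 0$. (Set $W(v\to v)=W(v\to 0)=0$.) A *spanning tree* is a set of edges of $G$ without directed cycles in which every word has exactly one incoming edge; a *dependency tree* is a spanning tree with exactly one edge leaving ROOT. Let $D$ be the set of dependency trees, $\phi(t)=\prod_{e\in t}\phi(e)$, and $Z_D=\sum_{t\in D}\phi(t)$. Assume $Z_D>0$. Wilson's algorithm starts with $\mathrm{visited}=\{0\}$ and an empty pointer table $t$, and for $i=1,\dots,n$ does the following: set $u\leftarrow i$; while $u\notin\mathrm{visited}$, sample a node $v$ with probability $W(v\to u)/\sum_{v'}W(v'\to u)$, set $t[u]\leftarrow v$ (overwriting any earlier value) and $u\leftarrow v$; then set $u\leftarrow i$ and, while $u\notin\mathrm{visited}$, add $u$ to $\mathrm{visited}$ and set $u\leftarrow t[u]$. It returns the edge set $\{t[u]\to u\}$. *WilsonReject* calls Wilson's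 algorithm on $G$ repeatedly, with fresh independent randomness, until the returned tree has exactly one edge leaving ROOT, and returns that tree. Then WilsonReject is an unbiased sampler of dependency trees: it halts with probability $1$; it returns each $t\in D$ with probability $$p(t)=\frac{\phi(t)}{Z_D}$$ and returns an edge set that is not in $D$ with probability $0$; and $k$ successive calls return independent trees, i.e. for every $k\ge 0$ and all $t_1,\dots,t_k$ the results are $(t_1,\dots,t_k)$ with probability $\prod_{i=1}^k p(t_i)$, where $p(t)=0$ for $t\notin D$. -/

import Mathlib

open scoped ENNReal

/-! ### Randomized programs

A randomized program with results in `α` is interpreted by its output law: `p a` is the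
probability that the program halts with result `a`. The total mass is the probability of halting;
it may be less than `1`. Every call of a program uses fresh, independent randomness. -/

/-- Output laws of randomized programs that need not halt. -/
def RandProg (α : Type) : Type := α → ℝ≥0∞

namespace RandProg

open Classical in
/-- Halt immediately with result `a`. -/
noncomputable def ret {α : Type} (a : α) : RandProg α := fun b => if b = a then 1 else 0

/-- The program that never returns a result. -/
def fail {α : Type} : RandProg α := fun _ => 0

/-- Run `p`, then run `f` on its result. -/
noncomputable def bind {α β : Type} (p : RandProg α) (f : α → RandProg β) : RandProg β :=
  fun b => ∑' a, p a * f a b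

open Classical in
/-- `while cond do body`, restricted to the runs in which `cond` is tested at most `k` times. -/
noncomputable def whileFuel {σ : Type} (cond : σ → Prop) (body : σ → RandProg σ) :
    ℕ → σ → RandProg σ
  | 0, _ => fail
  | k + 1, s => if cond s then bind (body s) (whileFuel cond body k) else ret s

/-- `while cond do body`: the probability of halting in a given state is the increasing limit of
the probabilities of halting in that state within `k` tests of `cond`. -/
noncomputable def whileLoop {σ : Type} (cond : σ → Prop) (body : σ → RandProg σ) (s : σ) :
    RandProg σ :=
  fun s' => ⨆ k : ℕ, whileFuel cond body k s s'

/-- `for i in l do body i`. -/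
noncomputable def forLoop {ι σ : Type} (body : ι → σ → RandProg σ) : List ι → σ → RandProg σ
  | [], s => ret s
  | i :: l, s => bind (body i s) (forLoop body l)

/-- Call `p` successively `k` times and return the sequence of the `k` results. -/
noncomputable def draws {α : Type} (p : RandProg α) : (k : ℕ) → RandProg (Fin k → α)
  | 0 => ret Fin.elim0
  | k + 1 => bind p fun a => bind (draws p k) fun as => ret (Fin.cons a as)

end RandProg

/-! ### Dependency graphs and trees -/

/-- The weighted dependency graph of a sentence with `n` words. The nodes are `Fin (n + 1)`, where
`0` is ROOT and the other nodes are the words; `W v u` is the weight of the edge `v → u`. -/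
structure DependencyGraph (n : ℕ) where
  W : Matrix (Fin (n + 1)) (Fin (n + 1)) ℝ
  nonneg : ∀ v u, 0 ≤ W v u
  diag_zero : ∀ v, W v v = 0
  root_col_zero : ∀ v, W v 0 = 0

/-- A set of directed edges; `(v, u)` is the edge `v → u`. -/
abbrev EdgeSet (n : ℕ) : Type := Finset (Fin (n + 1) × Fin (n + 1))

/-- A spanning tree: no edge enters ROOT or is a self-loop, every word has exactly one incoming
edge, and there is no directed cycle. -/
def IsSpanningTree {n : ℕ} (t : EdgeSet n) : Prop :=
  (∀ e ∈ t, e.2 ≠ 0 ∧ e.1 ≠ e.2) ∧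
  (∀ u : Fin (n + 1), u ≠ 0 → ∃! v, (v, u) ∈ t) ∧
  ∀ v : Fin (n + 1), ¬ Relation.TransGen (fun a b => (a, b) ∈ t) v v

/-- Exactly one edge leaves ROOT. -/
def HasSingleRootEdge {n : ℕ} (t : EdgeSet n) : Prop := ∃! v, ((0 : Fin (n + 1)), v) ∈ t

/-- A dependency tree: a spanning tree with exactly one edge leaving ROOT. -/
def IsDependencyTree {n : ℕ} (t : EdgeSet n) : Prop := IsSpanningTree t ∧ HasSingleRootEdge t

namespace DependencyGraph

variable {n : ℕ}

/-- The weight `φ(t)`, the product of the weights of the edges of `t`. -/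
noncomputable def treeWeight (G : DependencyGraph n) (t : EdgeSet n) : ℝ := ∏ e ∈ t, G.W e.1 e.2

open Classical in
/-- The partition function `Z_D`, the total weight of all dependency trees. -/
noncomputable def depPartition (G : DependencyGraph n) : ℝ :=
  ∑ t : EdgeSet n with IsDependencyTree t, G.treeWeight t

open Classical in
/-- The dependency-tree distribution: `φ(t) / Z_D` on dependency trees, `0` elsewhere. -/
noncomputable def depProb (G : DependencyGraph n) (t : EdgeSet n) : ℝ :=
  if IsDependencyTree t then G.treeWeight t / G.depPartition else 0

/-! ### Wilson's algorithm and rejection -/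

/-- Sample a node `v` with probability proportional to the weight of the edge `v → u`. If all these
weights are `0` there is nothing to sample and no result is returned. -/
noncomputable def sampleParent (G : DependencyGraph n) (u : Fin (n + 1)) :
    RandProg (Fin (n + 1)) :=
  fun v => ENNReal.ofReal (G.W v u / ∑ v', G.W v' u)

/-- A table of parent pointers; `t u = some v` stands for the edge `v → u`, and `t u = none` if no
edge into `u` has been chosen yet. -/
abbrev Pointers (n : ℕ) : Type := Fin (n + 1) → Option (Fin (n + 1))

/-- The random walk
`while u ∉ visited do { sample v with weight W v u; t[u] ← v; u ← v }`. -/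
noncomputable def randomWalk (G : DependencyGraph n) (visited : Finset (Fin (n + 1))) :
    Pointers n × Fin (n + 1) → RandProg (Pointers n × Fin (n + 1)) :=
  RandProg.whileLoop (fun s => s.2 ∉ visited) fun s =>
    RandProg.bind (G.sampleParent s.2) fun v =>
      RandProg.ret (Function.update s.1 s.2 (some v), v)

/-- The marking loop `while u ∉ visited do { visited ← visited ∪ {u}; u ← t[u] }`. -/
noncomputable def markVisited (t : Pointers n) :
    Finset (Fin (n + 1)) × Fin (n + 1) → RandProg (Finset (Fin (n + 1)) × Fin (n + 1)) :=
  RandProg.whileLoop (fun s => s.2 ∉ s.1) fun s =>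
    (t s.2).elim RandProg.fail fun v => RandProg.ret (insert s.2 s.1, v)

/-- One iteration of the outer loop, for the word `i`, on a state `(visited, t)`: walk from `i`
until a visited node is reached, then mark the nodes on the pointer path from `i`. -/
noncomputable def wilsonIteration (G : DependencyGraph n) (i : Fin (n + 1))
    (s : Finset (Fin (n + 1)) × Pointers n) : RandProg (Finset (Fin (n + 1)) × Pointers n) :=
  RandProg.bind (G.randomWalk s.1 (s.2, i)) fun w =>
    RandProg.bind (markVisited w.1 (s.1, i)) fun m =>
      RandProg.ret (m.1, w.1)

/-- The edges `v → u` with `t[u] = v`. -/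
def edgesOf (t : Pointers n) : EdgeSet n := Finset.univ.filter fun e => t e.2 = some e.1

/-- Wilson's algorithm: start with `visited = {ROOT}` and no pointers, process the words
`1, …, n` in this order, and return the edges of the pointer table. -/
noncomputable def wilson (G : DependencyGraph n) : RandProg (EdgeSet n) :=
  RandProg.bind
    (RandProg.forLoop G.wilsonIteration ((List.finRange n).map Fin.succ) ({0}, fun _ => none))
    fun s => RandProg.ret (edgesOf s.2)

/-- WilsonReject: `repeat t ← wilson G until t has exactly one ROOT edge; return t`. -/
noncomputable def wilsonReject (G : DependencyGraph n) : RandProg (EdgeSet n) :=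
  RandProg.bind G.wilson
    (RandProg.whileLoop (fun t => ¬ HasSingleRootEdge t) fun _ => G.wilson)

end DependencyGraph

/-! Wilson's algorithm draws each spanning tree with probability proportional to its weight;
conditioning on a single ROOT edge then gives the target law.

For Wilson's algorithm the claim is generalized to any root set `V` containing ROOT and any initial
table (`IsRooted.forLoop_apply`): a forest rooted in `V` is returned with probability
`pointerWeight` over `forestSum`. The induction is on the number of nodes outside `V`. The walk from
`i ∉ V` is cut at its first return to `i`. If it never returns, the run is one step `i → v` followed
by the algorithm with `i` added to the roots and started at `v`, which the induction hypothesis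
evaluates. If it returns, the situation is the original one with another table. This gives a linear
system `f = b + K f` (`forLoop_cons_eq_add`) with `b` independent of the table. Summing over all
forests, whose probabilities add up to 1, gives the row sums of `K`, and a maximum principle
(`mul_eq_of_eq_add_sum_mul`) determines `f`.

Halting with probability 1 comes from a minimum principle for the halting probability of the walk
(`IsRooted.sum_randomWalk`); `Z_D > 0` supplies the required positive path to ROOT. Rejection is
solved from its one-step equation (`wilsonReject_eq_add`). -/

namespace RandProg

variable {α β γ σ : Type}

/-! ### Algebra and total mass of output laws. -/

theorem bind_apply [Fintype α] (p : RandProg α) (f : α → RandProg β) (b : β) :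
    bind p f b = ∑ a, p a * f a b := tsum_fintype _

theorem ret_apply [DecidableEq α] (a b : α) : ret a b = if b = a then 1 else 0 := by
  unfold ret; congr

theorem ret_bind [Fintype α] (a : α) (f : α → RandProg β) : bind (ret a) f = f a := by
  classical
  funext b
  simp [bind_apply, ret_apply]

theorem bind_assoc [Fintype α] [Fintype β] (p : RandProg α) (f : α → RandProg β)
    (g : β → RandProg γ) : bind (bind p f) g = bind p fun a => bind (f a) g := by
  funext c
  simp only [bind_apply, Finset.sum_mul, Finset.mul_sum]
  rw [Finset.sum_comm]
  simp only [mul_assoc]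

theorem bind_mono [Fintype α] {p q : RandProg α} {f g : α → RandProg β} (hp : ∀ a, p a ≤ q a)
    (hf : ∀ a b, f a b ≤ g a b) (b : β) : bind p f b ≤ bind q g b := by
  simp only [bind_apply]
  exact Finset.sum_le_sum fun a _ => mul_le_mul' (hp a) (hf a b)

theorem exists_of_bind_ne_zero [Fintype α] {p : RandProg α} {f : α → RandProg β} {b : β}
    (h : bind p f b ≠ 0) : ∃ a, p a ≠ 0 ∧ f a b ≠ 0 := by
  rw [bind_apply] at h
  obtain ⟨a, -, ha⟩ := Finset.exists_ne_zero_of_sum_ne_zero h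
  exact ⟨a, left_ne_zero_of_mul ha, right_ne_zero_of_mul ha⟩

theorem eq_of_ret_ne_zero {a b : α} (h : ret a b ≠ 0) : b = a := by
  classical
  rw [ret_apply] at h
  by_contra hb
  simp [hb] at h

theorem sum_ret [Fintype α] (a : α) : ∑ b, ret a b = 1 := by
  classical
  simp [ret_apply]

theorem sum_bind [Fintype α] [Fintype β] (p : RandProg α) (f : α → RandProg β) :
    ∑ b, bind p f b = ∑ a, p a * ∑ b, f a b := by
  simp only [bind_apply]
  rw [Finset.sum_comm]
  exact Finset.sum_congr rfl fun a _ => (Finset.mul_sum _ _ _).symm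

theorem sum_bind_eq_one [Fintype α] [Fintype β] {p : RandProg α} {f : α → RandProg β}
    (hp : ∑ a, p a = 1) (hf : ∀ a, p a ≠ 0 → ∑ b, f a b = 1) : ∑ b, bind p f b = 1 := by
  rw [sum_bind, ← hp]
  refine Finset.sum_congr rfl fun a _ => ?_
  by_cases ha : p a = 0
  · simp [ha]
  · rw [hf a ha, mul_one]

theorem bind_congr_of_ne_zero [Fintype α] {p : RandProg α} {f g : α → RandProg β} {b : β}
    (h : ∀ a, p a ≠ 0 → f a b = g a b) : bind p f b = bind p g b := by
  simp only [bind_apply]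
  refine Finset.sum_congr rfl fun a _ => ?_
  by_cases ha : p a = 0
  · simp [ha]
  · rw [h a ha]

/-! ### While loops -/

variable {c c' : σ → Prop} {body : σ → RandProg σ}

theorem whileFuel_le_succ [Fintype σ] (k : ℕ) (s s' : σ) :
    whileFuel c body k s s' ≤ whileFuel c body (k + 1) s s' := by
  induction k generalizing s s' with
  | zero => exact zero_le
  | succ k ih =>
    rw [whileFuel, whileFuel]
    split_ifs
    · exact bind_mono (fun _ => le_rfl) (fun a b => ih a b) _
    · exact le_rfl

theorem whileFuel_monotone [Fintype σ] (s s' : σ) :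
    Monotone fun k => whileFuel c body k s s' :=
  monotone_nat_of_le_succ fun k => whileFuel_le_succ k s s'

/-- Finite sums commute with increasing suprema, and the fuelled laws increase with the fuel. -/
theorem bind_whileLoop [Fintype σ] (p : RandProg α) [Fintype α] (g : α → σ) (s' : σ) :
    bind p (fun a => whileLoop c body (g a)) s' =
      ⨆ k, bind p (fun a => whileFuel c body k (g a)) s' := by
  simp only [bind_apply, whileLoop, ENNReal.mul_iSup]
  refine ENNReal.finsetSum_iSup_of_monotone fun a => ?_
  exact fun k l h => mul_le_mul' le_rfl (whileFuel_monotone _ _ h)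

theorem whileLoop_of_not (s : σ) (h : ¬ c s) : whileLoop c body s = ret s := by
  funext s'
  refine le_antisymm (iSup_le fun k => ?_) ?_
  · cases k with
    | zero => exact zero_le
    | succ k => rw [whileFuel, if_neg h]
  · refine le_iSup_of_le 1 ?_
    rw [whileFuel, if_neg h]

theorem whileLoop_of_cond [Fintype σ] (s : σ) (h : c s) :
    whileLoop c body s = bind (body s) (whileLoop c body) := by
  funext s'
  have h1 := bind_whileLoop (c := c) (body := body) (body s) id s'
  simp only [id] at h1
  rw [show bind (body s) (whileLoop c body) s' = _ from h1]
  refine le_antisymm (iSup_le fun k => ?_) (iSup_le fun k => ?_)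
  · refine le_trans (whileFuel_le_succ k s s') (le_iSup_of_le k ?_)
    rw [whileFuel, if_pos h]
  · refine le_iSup_of_le (k + 1) ?_
    rw [whileFuel, if_pos h]

/-- A while loop may be interrupted at a stronger condition and then resumed. -/
theorem whileLoop_split [Fintype σ] (hc : ∀ s, c' s → c s) (s : σ) :
    whileLoop c body s = bind (whileLoop c' body s) (whileLoop c body) := by
  funext s'
  refine le_antisymm (iSup_le fun k => ?_) ?_
  -- Induction on the fuel of the uninterrupted loop here; the converse uses the fuel of the
  -- interrupted one.
  · induction k generalizing s s' with
    | zero => exact zero_le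
    | succ k ih =>
      by_cases h : c' s
      · rw [whileFuel, if_pos (hc s h), whileLoop_of_cond s h, bind_assoc]
        exact bind_mono (fun _ => le_rfl) (fun a b => ih a b) _
      · rw [whileLoop_of_not s h, ret_bind]
        exact le_iSup (fun k => whileFuel c body k s s') (k + 1)
  · have h1 : bind (whileLoop c' body s) (whileLoop c body) s' =
        ⨆ k, bind (whileFuel c' body k s) (whileLoop c body) s' := by
      simp only [bind_apply]
      refine Eq.trans ?_ (ENNReal.finsetSum_iSup_of_monotone
        (f := fun a k => whileFuel c' body k s a * whileLoop c body a s')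
        fun a k l h => mul_le_mul' (whileFuel_monotone _ _ h) le_rfl)
      exact Finset.sum_congr rfl fun a _ => ENNReal.iSup_mul _ _
    rw [h1]
    clear h1
    refine iSup_le fun k => ?_
    induction k generalizing s s' with
    | zero =>
      rw [bind_apply]
      simp [whileFuel, fail]
    | succ k ih =>
      rw [whileFuel]
      split_ifs with h
      · rw [whileLoop_of_cond s (hc s h), bind_assoc]
        exact bind_mono (fun _ => le_rfl) (fun a b => ih a b) _
      · rw [ret_bind]

theorem whileLoop_invariant [Fintype σ] {I : σ → Prop}
    (hI : ∀ s s', I s → c s → body s s' ≠ 0 → I s') {s s' : σ} (hs : I s)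
    (h : whileLoop c body s s' ≠ 0) : I s' ∧ ¬ c s' := by
  have h0 : ∃ k, whileFuel c body k s s' ≠ 0 := by
    by_contra! h0
    exact h (by simp [whileLoop, h0])
  obtain ⟨k, hk⟩ := h0
  induction k generalizing s with
  | zero => exact absurd rfl hk
  | succ k ih =>
    rw [whileFuel] at hk
    split_ifs at hk with hcs
    · obtain ⟨a, ha, ha'⟩ := exists_of_bind_ne_zero hk
      refine ih (hI s a hs hcs ha) ?_ ha'
      intro h1
      exact ha' (le_antisymm (h1 ▸ le_iSup (fun k => whileFuel c body k a s') k) zero_le)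
    · obtain rfl := eq_of_ret_ne_zero hk
      exact ⟨hs, hcs⟩

theorem sum_whileLoop_le_one [Fintype σ] (hb : ∀ s, ∑ s', body s s' ≤ 1) (s : σ) :
    ∑ s', whileLoop c body s s' ≤ 1 := by
  simp only [whileLoop]
  rw [ENNReal.finsetSum_iSup_of_monotone fun s' => whileFuel_monotone s s']
  refine iSup_le fun k => ?_
  induction k generalizing s with
  | zero => simp [whileFuel, fail]
  | succ k ih =>
    rw [whileFuel]
    split_ifs
    · rw [sum_bind]
      exact le_trans (Finset.sum_le_sum fun a _ => mul_le_mul' le_rfl (ih a))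
        (by simpa using hb s)
    · rw [sum_ret]

/-! ### For loops and repeated calls. -/

theorem sum_forLoop_eq_one {ι : Type} [Fintype σ] {body : ι → σ → RandProg σ} {I : σ → Prop}
    (hI : ∀ i s s', I s → body i s s' ≠ 0 → I s')
    (hb : ∀ i s, I s → ∑ s', body i s s' = 1) (l : List ι) {s : σ} (hs : I s) :
    ∑ s', forLoop body l s s' = 1 := by
  induction l generalizing s with
  | nil => exact sum_ret s
  | cons i l ih => exact sum_bind_eq_one (hb i s hs) fun a ha => ih (hI i s a hs ha)

theorem draws_apply [Fintype α] (p : RandProg α) (k : ℕ) (as : Fin k → α) :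
    draws p k as = ∏ i, p (as i) := by
  classical
  induction k with
  | zero => simp [draws, ret_apply, eq_iff_true_of_subsingleton]
  | succ k ih =>
    rw [draws, bind_apply, Finset.sum_eq_single (as 0), bind_apply,
      Finset.sum_eq_single (Fin.tail as), ih, ret_apply, if_pos (Fin.cons_self_tail as).symm,
      mul_one, Fin.prod_univ_succ]
    · rfl
    · intro b _ hb
      rw [ret_apply, if_neg, mul_zero]
      intro h
      exact hb (by rw [h, Fin.tail_cons])
    · simp
    · intro a _ ha
      rw [bind_apply, Finset.sum_eq_zero, mul_zero]
      intro b _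
      rw [ret_apply, if_neg, mul_zero]
      intro h
      exact ha (by rw [h, Fin.cons_zero])
    · simp

end RandProg

namespace DependencyGraph

variable {n : ℕ}

/-! ### Following pointers -/

/-- `t` has a pointer from `x`, which is not one of the roots in `V`, to `y`. -/
def Follows (V : Finset (Fin (n + 1))) (t : Pointers n) (x y : Fin (n + 1)) : Prop :=
  x ∉ V ∧ t x = some y

/-- Following the pointers of `t` from `x`, without leaving a root in `V`, one comes to `y`. -/
abbrev Leads (V : Finset (Fin (n + 1))) (t : Pointers n) : Fin (n + 1) → Fin (n + 1) → Prop :=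
  Relation.ReflTransGen (Follows V t)

/-- Outside `V`, the pointer table is a forest with roots in `V`. -/
def RootedAt (V : Finset (Fin (n + 1))) (t : Pointers n) : Prop :=
  ∀ u, ∃ r ∈ V, Leads V t u r

variable {V V' : Finset (Fin (n + 1))} {t t' : Pointers n}

theorem Leads.anti (hV : V ⊆ V') {x y : Fin (n + 1)} (h : Leads V' t x y) : Leads V t x y :=
  Relation.ReflTransGen.mono (fun _ _ hab => ⟨fun ha => hab.1 (hV ha), hab.2⟩) _ _ h

/-- The path can be cut at its first visit to `u`, before the altered pointer is read. -/
theorem Leads.update {i u : Fin (n + 1)} (h : Leads V t i u) (v : Option (Fin (n + 1))) :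
    Leads V (Function.update t u v) i u := by
  induction h using Relation.ReflTransGen.head_induction_on with
  | refl => exact .refl
  | @head a b hab _ ih =>
    by_cases hau : a = u
    · rw [hau]
    · exact .head ⟨hab.1, by rw [Function.update_of_ne hau, hab.2]⟩ ih

theorem Leads.update_tail {i u : Fin (n + 1)} (h : Leads V t i u) (hu : u ∉ V)
    (v : Fin (n + 1)) : Leads V (Function.update t u (some v)) i v :=
  (h.update _).tail ⟨hu, by simp⟩

theorem Leads.congr_of_closed {C : Finset (Fin (n + 1))}
    (hC : ∀ x ∈ C, x ∉ V → ∀ y, t x = some y → y ∈ C) (ht : ∀ x ∈ C, x ∉ V → t' x = t x)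
    {x y : Fin (n + 1)} (hx : x ∈ C) (h : Leads V t x y) : Leads V t' x y := by
  induction h using Relation.ReflTransGen.head_induction_on with
  | refl => exact .refl
  | @head a b hab _ ih =>
    exact .head ⟨hab.1, by rw [ht a hx hab.1, hab.2]⟩ (ih (hC a hx hab.1 b hab.2))

theorem Leads.eq_of_mem {x y : Fin (n + 1)} (h : Leads V t x y) (hx : x ∈ V) : x = y := by
  rcases Relation.ReflTransGen.cases_head h with h | ⟨z, hz, -⟩
  · exact h
  · exact absurd hx hz.1

theorem RootedAt.exists_eq_some (h : RootedAt V t) {u : Fin (n + 1)} (hu : u ∉ V) :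
    ∃ v, t u = some v := by
  obtain ⟨r, hr, hur⟩ := h u
  rcases Relation.ReflTransGen.cases_head hur with rfl | ⟨z, hz, -⟩
  · exact absurd hr hu
  · exact ⟨z, hz.2⟩

/-- Pointers are deterministic, so on a cycle through `i` every node reachable from `i` leads back
to `i`. This would apply to the root reached from `i`, but a root leads only to itself. -/
theorem RootedAt.not_leads (h : RootedAt V t) {i v : Fin (n + 1)} (hi : i ∉ V)
    (hv : t i = some v) : ¬ Leads V t v i := by
  intro hvi
  have key : ∀ x, Leads V t i x → Leads V t x i := by
    intro x hx
    induction hx with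
    | refl => exact .refl
    | @tail b c _ hbc ih =>
      rcases Relation.ReflTransGen.cases_head ih with rfl | ⟨z, hz, hzi⟩
      · rwa [← Option.some.inj (hv.symm.trans hbc.2)]
      · rwa [← Option.some.inj (hz.2.symm.trans hbc.2)]
  obtain ⟨r, hr, hir⟩ := h i
  exact hi ((key r hir).eq_of_mem hr ▸ hr)

theorem RootedAt.mono (h : RootedAt V t) (hV : V ⊆ V') (ht : ∀ x, x ∉ V' → t' x = t x) :
    RootedAt V' t' := by
  intro u
  obtain ⟨r, hr, hur⟩ := h u
  induction hur using Relation.ReflTransGen.head_induction_on with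
  | refl => exact ⟨r, hV hr, .refl⟩
  | @head a b hab _ ih =>
    by_cases ha : a ∈ V'
    · exact ⟨a, ha, .refl⟩
    · obtain ⟨s, hs, hbs⟩ := ih
      exact ⟨s, hs, .head ⟨ha, by rw [ht a ha, hab.2]⟩ hbs⟩

/-- `V'` contains `V`, the pointers of `t` and `t'` agree on `V`, and the pointers of `t'` lead from
each node of `V'` to `V` inside `V'`. -/
structure Extends (V : Finset (Fin (n + 1))) (t : Pointers n) (V' : Finset (Fin (n + 1)))
    (t' : Pointers n) : Prop where
  subset : V ⊆ V'
  agree : ∀ x ∈ V, t' x = t x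
  closed : ∀ x ∈ V', x ∉ V → ∀ y, t' x = some y → y ∈ V'
  leads : ∀ x ∈ V', ∃ r ∈ V, Leads V t' x r

theorem Extends.refl (V : Finset (Fin (n + 1))) (t : Pointers n) : Extends V t V t :=
  ⟨subset_rfl, fun _ _ => rfl, fun _ h h' => absurd h h', fun x hx => ⟨x, hx, .refl⟩⟩

theorem Extends.trans {V'' : Finset (Fin (n + 1))} {t'' : Pointers n} (h : Extends V t V' t')
    (h' : Extends V' t' V'' t'') : Extends V t V'' t'' where
  subset := h.subset.trans h'.subset
  agree x hx := (h'.agree x (h.subset hx)).trans (h.agree x hx)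
  closed x hx hxV y hy := by
    by_cases hx' : x ∈ V'
    · exact h'.subset (h.closed x hx' hxV y (h'.agree x hx' ▸ hy))
    · exact h'.closed x hx hx' y hy
  leads x hx := by
    obtain ⟨r', hr', h1⟩ := h'.leads x hx
    obtain ⟨r, hr, h2⟩ := h.leads r' hr'
    exact ⟨r, hr, (h1.anti h.subset).trans
      (h2.congr_of_closed h.closed (fun x hx _ => h'.agree x hx) hr')⟩

/-! ### Marking -/

theorem markVisited_of_mem {u : Fin (n + 1)} (hu : u ∈ V) :
    markVisited t (V, u) = RandProg.ret (V, u) :=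
  RandProg.whileLoop_of_not _ (by simpa using hu)

theorem markVisited_of_notMem {u v : Fin (n + 1)} (hu : u ∉ V) (hv : t u = some v) :
    markVisited t (V, u) = markVisited t (insert u V, v) := by
  rw [markVisited, RandProg.whileLoop_of_cond _ (by simpa using hu)]
  simp only [hv, Option.elim]
  rw [RandProg.ret_bind]

/-- Marking is deterministic and ends because the pointers lead to a root. `V'` varies while `V` is
fixed: the visited set grows along the path, whereas the path is taken relative to the original
roots. -/
theorem exists_markVisited_eq_ret {u r : Fin (n + 1)} (h : Leads V t u r) (hr : r ∈ V)
    (hV : V ⊆ V') : ∃ V'' w, markVisited t (V', u) = RandProg.ret (V'', w) ∧ V' ⊆ V'' ∧ u ∈ V'' ∧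
      (∀ x ∈ V'', x ∉ V' → ∀ y, t x = some y → y ∈ V'') ∧
      ∀ x ∈ V'', x ∉ V' → Leads V t x r := by
  induction h using Relation.ReflTransGen.head_induction_on generalizing V' with
  | refl =>
    exact ⟨V', r, markVisited_of_mem (hV hr), subset_rfl, hV hr, fun _ h h' => absurd h h',
      fun _ h h' => absurd h h'⟩
  | @head a b hab hbr ih =>
    by_cases ha : a ∈ V'
    · exact ⟨V', a, markVisited_of_mem ha, subset_rfl, ha, fun _ h h' => absurd h h',
        fun _ h h' => absurd h h'⟩
    · obtain ⟨V'', w, h1, h2, h3, h4, h5⟩ := ih (hV.trans (Finset.subset_insert a V'))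
      refine ⟨V'', w, (markVisited_of_notMem ha hab.2).trans h1,
        (Finset.subset_insert a V').trans h2, h2 (Finset.mem_insert_self a V'), ?_, ?_⟩
      · intro x hx hxV y hy
        by_cases hxa : x = a
        · subst hxa
          rwa [Option.some.inj (hy.symm.trans hab.2)]
        · exact h4 x hx (by simp [hxa, hxV]) y hy
      · intro x hx hxV
        by_cases hxa : x = a
        · subst hxa
          exact .head hab hbr
        · exact h5 x hx (by simp [hxa, hxV])

/-! ### The random walk -/

variable (G : DependencyGraph n)

theorem randomWalk_of_mem {u : Fin (n + 1)} (hu : u ∈ V) :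
    G.randomWalk V (t, u) = RandProg.ret (t, u) :=
  RandProg.whileLoop_of_not _ (by simpa using hu)

theorem randomWalk_of_notMem {u : Fin (n + 1)} (hu : u ∉ V) :
    G.randomWalk V (t, u) = RandProg.bind (G.sampleParent u) fun v =>
      G.randomWalk V (Function.update t u (some v), v) := by
  rw [randomWalk, RandProg.whileLoop_of_cond _ (by simpa using hu), RandProg.bind_assoc]
  simp only [RandProg.ret_bind]

theorem randomWalk_split (hV : V ⊆ V') (s : Pointers n × Fin (n + 1)) :
    G.randomWalk V s = RandProg.bind (G.randomWalk V' s) (G.randomWalk V) :=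
  RandProg.whileLoop_split (fun _ h h' => h (hV h')) s

/-- Overwriting pointers performs the loop erasure: at all times the current table leads from `i` to
the current node. -/
theorem randomWalk_support {i : Fin (n + 1)} {s : Pointers n × Fin (n + 1)}
    (h : G.randomWalk V (t, i) s ≠ 0) :
    s.2 ∈ V ∧ Leads V s.1 i s.2 ∧ ∀ x ∈ V, s.1 x = t x := by
  have := RandProg.whileLoop_invariant
    (I := fun s : Pointers n × Fin (n + 1) => Leads V s.1 i s.2 ∧ ∀ x ∈ V, s.1 x = t x)
    (fun s s' hs hc hb => ?_) ⟨.refl, fun _ _ => rfl⟩ h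
  · exact ⟨not_not.1 this.2, this.1⟩
  · obtain ⟨v, -, hv⟩ := RandProg.exists_of_bind_ne_zero hb
    obtain rfl := RandProg.eq_of_ret_ne_zero hv
    refine ⟨hs.1.update_tail hc v, fun x hx => ?_⟩
    rw [← hs.2 x hx]
    refine Function.update_of_ne (fun hxs => hc ?_) _ _
    rwa [← hxs]

theorem sampleParent_ne_top (u v : Fin (n + 1)) : G.sampleParent u v ≠ ⊤ := ENNReal.ofReal_ne_top

theorem sum_sampleParent (u : Fin (n + 1)) :
    ∑ v, G.sampleParent u v = ENNReal.ofReal ((∑ v, G.W v u) / ∑ v, G.W v u) := by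
  rw [Finset.sum_div, ENNReal.ofReal_sum_of_nonneg]
  · rfl
  · exact fun v _ => div_nonneg (G.nonneg v u) (Finset.sum_nonneg fun v _ => G.nonneg v u)

theorem sum_sampleParent_le_one (u : Fin (n + 1)) : ∑ v, G.sampleParent u v ≤ 1 := by
  rw [sum_sampleParent, ENNReal.ofReal_le_one]
  exact div_self_le_one _

theorem sum_sampleParent_eq_one {u v : Fin (n + 1)} (h : G.sampleParent u v ≠ 0) :
    ∑ v, G.sampleParent u v = 1 := by
  rw [sum_sampleParent, div_self, ENNReal.ofReal_one]
  intro h0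
  exact h (by simp [sampleParent, h0])

/-- Every word is connected to ROOT by edges of positive weight. -/
def IsRooted : Prop :=
  ∃ τ : Pointers n, RootedAt {0} τ ∧ ∀ u ≠ 0, ∀ v, τ u = some v → G.sampleParent u v ≠ 0

variable {G}

theorem IsRooted.sum_sampleParent (hG : G.IsRooted) {u : Fin (n + 1)} (hu : u ≠ 0) :
    ∑ v, G.sampleParent u v = 1 := by
  obtain ⟨τ, hτ, hp⟩ := hG
  obtain ⟨v, hv⟩ := hτ.exists_eq_some (u := u) (by simpa using hu)
  exact G.sum_sampleParent_eq_one (hp u hu v hv)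

theorem sum_randomWalk_le_one (s : Pointers n × Fin (n + 1)) :
    ∑ s', G.randomWalk V s s' ≤ 1 := by
  refine RandProg.sum_whileLoop_le_one (fun s => ?_) s
  rw [RandProg.sum_bind]
  simp only [RandProg.sum_ret, mul_one]
  exact G.sum_sampleParent_le_one _

/-- A weighted mean of numbers `≥ m` that equals `m` has no term `> m` of positive weight. -/
theorem eq_of_sum_mul_eq {ι : Type*} [Fintype ι] {p a : ι → ℝ≥0∞} {m : ℝ≥0∞} (hm : m ≠ ⊤)
    (hp : ∑ i, p i = 1) (ha : ∀ i, m ≤ a i) (h : ∑ i, p i * a i = m) {i : ι} (hi : p i ≠ 0) :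
    a i = m := by
  by_contra hne
  have hlt : m < a i := lt_of_le_of_ne (ha i) (Ne.symm hne)
  have hpi : p i ≠ ⊤ := by
    intro htop
    have : p i ≤ 1 := hp ▸ Finset.single_le_sum (fun _ _ => zero_le) (Finset.mem_univ i)
    simp [htop] at this
  have h1 : ∑ j, p j * m < ∑ j, p j * a j := by
    classical
    rw [← Finset.add_sum_erase _ _ (Finset.mem_univ i),
      ← Finset.add_sum_erase _ (fun j => p j * a j) (Finset.mem_univ i)]
    refine ENNReal.add_lt_add_of_lt_of_le ?_ (ENNReal.mul_lt_mul_right hi hpi hlt)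
      (Finset.sum_le_sum fun j _ => mul_le_mul' le_rfl (ha j))
    refine ne_top_of_le_ne_top hm ?_
    calc ∑ j ∈ Finset.univ.erase i, p j * m ≤ ∑ j, p j * m :=
          Finset.sum_le_sum_of_subset (Finset.subset_univ _)
      _ = m := by rw [← Finset.sum_mul, hp, one_mul]
  rw [h, ← Finset.sum_mul, hp, one_mul] at h1
  exact lt_irrefl _ h1

/-- The halting probability `m` is a weighted mean of its values after one step, and it attains a
minimum because there are finitely many states. The minimal value propagates along a positive path
towards ROOT until the path meets `V`, where `m = 1`. -/
theorem IsRooted.sum_randomWalk (hG : G.IsRooted) (h0 : 0 ∈ V) (s : Pointers n × Fin (n + 1)) :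
    ∑ s', G.randomWalk V s s' = 1 := by
  set m : Pointers n × Fin (n + 1) → ℝ≥0∞ := fun s => ∑ s', G.randomWalk V s s' with hm
  have hstep : ∀ t u, u ∉ V →
      m (t, u) = ∑ v, G.sampleParent u v * m (Function.update t u (some v), v) := by
    intro t u hu
    simp only [hm, G.randomWalk_of_notMem hu, RandProg.sum_bind]
  have hmem : ∀ t, ∀ u ∈ V, m (t, u) = 1 := by
    intro t u hu
    simp only [hm, G.randomWalk_of_mem hu, RandProg.sum_ret]
  obtain ⟨⟨t₀, u₀⟩, hmin⟩ := Finite.exists_min m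
  have hle : ∀ s, m s ≤ 1 := fun s => sum_randomWalk_le_one s
  refine le_antisymm (hle s) (le_trans ?_ (hmin s))
  obtain ⟨τ, hτ, hp⟩ := id hG
  obtain ⟨r, hr, hur⟩ := hτ u₀
  obtain rfl : r = 0 := by simpa using hr
  -- The table is arbitrary because every step of the path changes it; only the minimal value is
  -- carried along.
  have key : ∀ t, m (t, u₀) = m (t₀, u₀) → 1 ≤ m (t₀, u₀) := by
    generalize m (t₀, u₀) = m₀ at hmin
    induction hur using Relation.ReflTransGen.head_induction_on with
    | refl => exact fun t ht => by rw [← ht, hmem t 0 h0]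
    | @head a b hab _ ih =>
      intro t ht
      by_cases ha : a ∈ V
      · rw [← ht, hmem t a ha]
      · have ha0 : a ≠ 0 := fun h => ha (h ▸ h0)
        refine ih (Function.update t a (some b)) ?_
        refine eq_of_sum_mul_eq (p := G.sampleParent a)
          (a := fun v => m (Function.update t a (some v), v)) ?_ (hG.sum_sampleParent ha0)
          (fun v => hmin _) (by rw [← hstep t a ha, ht]) (hp a ha0 b hab.2)
        exact ne_top_of_le_ne_top ENNReal.one_ne_top (ht ▸ hle _)
  exact key t₀ rfl

/-! ### Iterations of Wilson's algorithm -/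

theorem wilsonIteration_of_mem {i : Fin (n + 1)} (hi : i ∈ V) :
    G.wilsonIteration i (V, t) = RandProg.ret (V, t) := by
  rw [wilsonIteration]
  simp only [G.randomWalk_of_mem hi, RandProg.ret_bind, markVisited_of_mem hi]

theorem wilsonIteration_support {i : Fin (n + 1)}
    {s s' : Finset (Fin (n + 1)) × Pointers n} (h : G.wilsonIteration i s s' ≠ 0) :
    Extends s.1 s.2 s'.1 s'.2 ∧ i ∈ s'.1 := by
  obtain ⟨w, hw, h⟩ := RandProg.exists_of_bind_ne_zero h
  obtain ⟨hw1, hw2, hw3⟩ := G.randomWalk_support hw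
  obtain ⟨V'', w', h1, h2, h3, h4, h5⟩ := exists_markVisited_eq_ret hw2 hw1 subset_rfl
  rw [h1, RandProg.ret_bind] at h
  obtain rfl := RandProg.eq_of_ret_ne_zero h
  refine ⟨⟨h2, hw3, h4, fun x hx => ?_⟩, h3⟩
  by_cases hxV : x ∈ s.1
  · exact ⟨x, hxV, .refl⟩
  · exact ⟨w.2, hw1, h5 x hx hxV⟩

theorem forLoop_wilsonIteration_support {l : List (Fin (n + 1))}
    {s s' : Finset (Fin (n + 1)) × Pointers n}
    (h : RandProg.forLoop G.wilsonIteration l s s' ≠ 0) :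
    Extends s.1 s.2 s'.1 s'.2 ∧ ∀ i ∈ l, i ∈ s'.1 := by
  induction l generalizing s with
  | nil =>
    obtain rfl := RandProg.eq_of_ret_ne_zero h
    exact ⟨.refl _ _, by simp⟩
  | cons i l ih =>
    obtain ⟨a, ha, h⟩ := RandProg.exists_of_bind_ne_zero h
    obtain ⟨h1, h2⟩ := wilsonIteration_support ha
    obtain ⟨h3, h4⟩ := ih h
    refine ⟨h1.trans h3, fun j hj => ?_⟩
    rcases List.mem_cons.1 hj with rfl | hj
    · exact h3.subset h2
    · exact h4 j hj

theorem IsRooted.sum_wilsonIteration (hG : G.IsRooted) (i : Fin (n + 1))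
    (s : Finset (Fin (n + 1)) × Pointers n) (h0 : 0 ∈ s.1) :
    ∑ s', G.wilsonIteration i s s' = 1 := by
  rw [wilsonIteration]
  refine RandProg.sum_bind_eq_one (hG.sum_randomWalk h0 _) fun w hw => ?_
  obtain ⟨hw1, hw2, -⟩ := G.randomWalk_support hw
  obtain ⟨V'', w', h1, -⟩ := exists_markVisited_eq_ret hw2 hw1 subset_rfl
  rw [h1, RandProg.ret_bind, RandProg.sum_ret]

theorem IsRooted.sum_forLoop (hG : G.IsRooted) (l : List (Fin (n + 1)))
    (s : Finset (Fin (n + 1)) × Pointers n) (h0 : 0 ∈ s.1) :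
    ∑ s', RandProg.forLoop G.wilsonIteration l s s' = 1 :=
  RandProg.sum_forLoop_eq_one (I := fun s => 0 ∈ s.1)
    (fun _ _ _ hs h => (wilsonIteration_support h).1.subset hs)
    (fun i s hs => hG.sum_wilsonIteration i s hs) l h0

end DependencyGraph

namespace DependencyGraph

variable {n : ℕ} {V : Finset (Fin (n + 1))} {t τ : Pointers n} {G : DependencyGraph n}

/-! ### The law of the final pointer table -/

/-- The product of the sampling probabilities of the pointers outside `V`. -/
noncomputable def pointerWeight (G : DependencyGraph n) (V : Finset (Fin (n + 1)))
    (τ : Pointers n) : ℝ≥0∞ :=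
  ∏ u ∈ Vᶜ, (τ u).elim 0 fun v => G.sampleParent u v

open Classical in
/-- The pointer tables that agree with `t` on `V` and are forests with roots in `V`. -/
noncomputable def forests (V : Finset (Fin (n + 1))) (t : Pointers n) : Finset (Pointers n) :=
  {τ | (∀ u ∈ V, τ u = t u) ∧ RootedAt V τ}

theorem mem_forests : τ ∈ forests V t ↔ (∀ u ∈ V, τ u = t u) ∧ RootedAt V τ := by
  simp [forests]

theorem forests_congr {t' : Pointers n} (h : ∀ u ∈ V, t' u = t u) : forests V t' = forests V t := by
  ext τ
  rw [mem_forests, mem_forests]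
  exact and_congr_left fun _ => forall₂_congr fun u hu => by rw [h u hu]

/-- The total weight of the forests with roots in `V`. -/
noncomputable def forestSum (G : DependencyGraph n) (V : Finset (Fin (n + 1))) : ℝ≥0∞ :=
  ∑ τ ∈ forests V fun _ => none, G.pointerWeight V τ

/-- Weight and rootedness read only the pointers outside `V`, so those on `V` can be exchanged
freely. -/
theorem sum_forests (t : Pointers n) : ∑ τ ∈ forests V t, G.pointerWeight V τ = G.forestSum V := by
  refine Finset.sum_nbij' (fun τ u => if u ∈ V then none else τ u)
    (fun τ u => if u ∈ V then t u else τ u) ?_ ?_ ?_ ?_ ?_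
  · intro τ hτ
    exact mem_forests.2 ⟨fun u hu => if_pos hu,
      (mem_forests.1 hτ).2.mono subset_rfl fun x hx => if_neg hx⟩
  · intro τ hτ
    exact mem_forests.2 ⟨fun u hu => if_pos hu,
      (mem_forests.1 hτ).2.mono subset_rfl fun x hx => if_neg hx⟩
  · intro τ hτ
    funext u
    by_cases hu : u ∈ V
    · simp [hu, (mem_forests.1 hτ).1 u hu]
    · simp [hu]
  · intro τ hτ
    funext u
    by_cases hu : u ∈ V
    · simp [hu, (mem_forests.1 hτ).1 u hu]
    · simp [hu]
  · intro τ hτ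
    refine Finset.prod_congr rfl fun u hu => ?_
    exact congrArg (fun o : Option (Fin (n + 1)) => o.elim 0 fun v => G.sampleParent u v)
      (if_neg (Finset.mem_compl.1 hu)).symm

theorem pointerWeight_ne_top : G.pointerWeight V τ ≠ ⊤ := by
  refine ENNReal.prod_ne_top fun u _ => ?_
  cases τ u with
  | none => exact ENNReal.zero_ne_top
  | some v => exact G.sampleParent_ne_top u v

theorem forestSum_ne_top : G.forestSum V ≠ ⊤ :=
  ENNReal.sum_ne_top.2 fun _ _ => pointerWeight_ne_top

theorem IsRooted.forestSum_ne_zero (hG : G.IsRooted) (h0 : 0 ∈ V) : G.forestSum V ≠ 0 := by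
  obtain ⟨τ, hτ, hp⟩ := hG
  have hτV : RootedAt V τ := hτ.mono (by simpa using h0) fun _ _ => rfl
  rw [← sum_forests τ]
  refine fun h => ?_
  have h1 := Finset.sum_eq_zero_iff.1 h τ (mem_forests.2 ⟨fun _ _ => rfl, hτV⟩)
  obtain ⟨u, hu, hu'⟩ := Finset.prod_eq_zero_iff.1 h1
  have huV : u ∉ V := Finset.mem_compl.1 hu
  obtain ⟨v, hv⟩ := hτV.exists_eq_some huV
  rw [hv] at hu'
  exact hp u (fun h => huV (h ▸ h0)) v hv hu'

theorem pointerWeight_eq_mul {i v : Fin (n + 1)} (hi : i ∉ V) (hv : τ i = some v) :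
    G.pointerWeight V τ = G.sampleParent i v * G.pointerWeight (insert i V) τ := by
  rw [pointerWeight, ← Finset.mul_prod_erase _ _ (Finset.mem_compl.2 hi), hv, pointerWeight,
    Finset.compl_insert]
  rfl

theorem mem_forests_of_forLoop_ne_zero {l : List (Fin (n + 1))}
    (h : RandProg.forLoop G.wilsonIteration l (V, t) (Finset.univ, τ) ≠ 0) : τ ∈ forests V t := by
  obtain ⟨h1, -⟩ := forLoop_wilsonIteration_support h
  exact mem_forests.2 ⟨h1.agree, fun u => h1.leads u (Finset.mem_univ u)⟩

/-- Every listed node ends up visited, so the mass sits on the full visited set. -/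
theorem sum_forLoop_univ {l : List (Fin (n + 1))} (hl : ∀ u ∉ V, u ∈ l) :
    ∑ τ, RandProg.forLoop G.wilsonIteration l (V, t) (Finset.univ, τ) =
      ∑ s, RandProg.forLoop G.wilsonIteration l (V, t) s := by
  symm
  refine (Fintype.sum_prod_type fun s =>
    RandProg.forLoop G.wilsonIteration l (V, t) s).trans (Finset.sum_eq_single Finset.univ ?_ ?_)
  · intro V' _ hV'
    refine Finset.sum_eq_zero fun τ _ => ?_
    by_contra h
    obtain ⟨h1, h2⟩ := forLoop_wilsonIteration_support h
    refine hV' (Finset.eq_univ_of_forall fun u => ?_)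
    by_cases hu : u ∈ V
    · exact h1.subset hu
    · exact h2 u (hl u hu)
  · simp

theorem IsRooted.sum_forLoop_forests (hG : G.IsRooted) (h0 : 0 ∈ V) {l : List (Fin (n + 1))}
    (hl : ∀ u ∉ V, u ∈ l) :
    ∑ τ ∈ forests V t, RandProg.forLoop G.wilsonIteration l (V, t) (Finset.univ, τ) = 1 := by
  rw [← hG.sum_forLoop l (V, t) h0, ← sum_forLoop_univ hl]
  refine Finset.sum_subset (Finset.subset_univ _) fun τ _ hτ => ?_
  by_contra h
  exact hτ (mem_forests_of_forLoop_ne_zero h)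

theorem forLoop_wilsonIteration_cons (i : Fin (n + 1)) (l : List (Fin (n + 1))) :
    RandProg.forLoop G.wilsonIteration (i :: l) (V, t) =
      RandProg.bind (G.randomWalk V (t, i)) fun w =>
        RandProg.bind (markVisited w.1 (V, i)) fun m =>
          RandProg.forLoop G.wilsonIteration l (m.1, w.1) := by
  rw [RandProg.forLoop, wilsonIteration, RandProg.bind_assoc]
  simp only [RandProg.bind_assoc, RandProg.ret_bind]

/-! ### Decomposition at the first return. -/

/-- The probability that the walk from `i ∉ V` with pointer table `t` returns to `i` before it
reaches `V`, with pointer table `t'` at the time of the first return. -/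
noncomputable def returnProb (G : DependencyGraph n) (V : Finset (Fin (n + 1))) (i : Fin (n + 1))
    (t t' : Pointers n) : ℝ≥0∞ :=
  ∑ v, G.sampleParent i v * G.randomWalk (insert i V) (Function.update t i (some v), v) (t', i)

theorem agree_of_returnProb_ne_zero {i : Fin (n + 1)} {t' : Pointers n} (hi : i ∉ V)
    (h : G.returnProb V i t t' ≠ 0) : ∀ u ∈ V, t' u = t u := by
  obtain ⟨v, -, hv⟩ := Finset.exists_ne_zero_of_sum_ne_zero h
  obtain ⟨-, -, h1⟩ := G.randomWalk_support (right_ne_zero_of_mul hv)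
  intro u hu
  refine (h1 u (Finset.mem_insert_of_mem hu)).trans (Function.update_of_ne ?_ _ _)
  rintro rfl
  exact hi hu

/-- A walk stopped on `V ∪ {i}` is either in `V`, where the continued walk stops at once, or back at
`i`, where it restarts with the new table. -/
theorem randomWalk_insert_bind {β : Type} {i v : Fin (n + 1)}
    (R : Pointers n × Fin (n + 1) → RandProg β) (x : β) :
    RandProg.bind (G.randomWalk (insert i V) (t, v))
        (fun s => RandProg.bind (G.randomWalk V s) R) x =
      RandProg.bind (G.randomWalk (insert i V) (t, v))
        (fun s x => if s.2 = i then 0 else R s x) x +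
      ∑ t', G.randomWalk (insert i V) (t, v) (t', i) *
        RandProg.bind (G.randomWalk V (t', i)) R x := by
  have h1 : ∑ t', G.randomWalk (insert i V) (t, v) (t', i) *
      RandProg.bind (G.randomWalk V (t', i)) R x = ∑ s, G.randomWalk (insert i V) (t, v) s *
      (if s.2 = i then RandProg.bind (G.randomWalk V s) R x else 0) := by
    rw [Fintype.sum_prod_type]
    refine Finset.sum_congr rfl fun t' _ => ?_
    rw [Finset.sum_eq_single i]
    · simp
    · intro j _ hj
      simp [hj]
    · simp
  rw [h1]
  refine (RandProg.bind_apply _ _ _).trans (Eq.trans ?_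
    (congrArg (· + _) (RandProg.bind_apply _ _ _).symm))
  refine Eq.trans ?_ Finset.sum_add_distrib
  refine Finset.sum_congr rfl fun s _ => ?_
  rw [← mul_add]
  by_cases hs : G.randomWalk (insert i V) (t, v) s = 0
  · rw [hs, zero_mul, zero_mul]
  · congr 1
    by_cases hsi : s.2 = i
    · simp [hsi]
    · have hsV : s.2 ∈ V := by
        simpa [hsi] using (G.randomWalk_support hs).1
      rw [if_neg hsi, if_neg hsi, add_zero, ← Prod.mk.eta (p := s), G.randomWalk_of_mem hsV,
        RandProg.ret_bind]

/-- If the final pointers form a forest with roots in `V`, then a walk from `i` to `V` that does not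
return to `i` amounts to a step from `i` to some `v` and a walk from `v` to `V ∪ {i}`. -/
theorem bind_randomWalk_insert_eq_forLoop {i v : Fin (n + 1)} (hi : i ∉ V) (hτ : RootedAt V τ)
    (ht : t i = some v) (l : List (Fin (n + 1))) :
    RandProg.bind (G.randomWalk (insert i V) (t, v))
        (fun s x => if s.2 = i then 0 else
          RandProg.bind (markVisited s.1 (V, i))
            (fun m => RandProg.forLoop G.wilsonIteration l (m.1, s.1)) x) (Finset.univ, τ) =
      RandProg.forLoop G.wilsonIteration (v :: l) (insert i V, t) (Finset.univ, τ) := by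
  rw [forLoop_wilsonIteration_cons]
  refine RandProg.bind_congr_of_ne_zero fun s hs => ?_
  obtain ⟨h1, h2, h3⟩ := G.randomWalk_support hs
  have hsi : s.1 i = some v := (h3 i (Finset.mem_insert_self i V)).trans ht
  split_ifs with hs2
  -- If the walk from `v` ends at `i`, later iterations keep the marked path from `v` to `i` and the
  -- pointer from `i` to `v`. This cycle is impossible in `τ`, so the right-hand side vanishes too.
  · symm
    by_contra h
    obtain ⟨V'', w, hm, hV, hv, hc, -⟩ := exists_markVisited_eq_ret h2 h1 subset_rfl
    rw [hm, RandProg.ret_bind] at h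
    obtain ⟨h4, -⟩ := forLoop_wilsonIteration_support h
    refine hτ.not_leads hi (v := v) ?_ ?_
    · exact (h4.agree i (hV (Finset.mem_insert_self i V))).trans hsi
    · rw [hs2] at h2
      exact (h2.congr_of_closed hc (fun x hx _ => h4.agree x hx) hv).anti
        (Finset.subset_insert i V)
  · rw [markVisited_of_notMem hi hsi]

/-- Renewal equation: the first sum collects the runs without return to `i`, the second the runs
that restart at the first return. -/
theorem forLoop_cons_eq_add {i : Fin (n + 1)} (hi : i ∉ V) (hτ : RootedAt V τ)
    (t : Pointers n) (l : List (Fin (n + 1))) :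
    RandProg.forLoop G.wilsonIteration (i :: l) (V, t) (Finset.univ, τ) =
      ∑ v, G.sampleParent i v * RandProg.forLoop G.wilsonIteration (v :: l)
        (insert i V, Function.update t i (some v)) (Finset.univ, τ) +
      ∑ t', G.returnProb V i t t' *
        RandProg.forLoop G.wilsonIteration (i :: l) (V, t') (Finset.univ, τ) := by
  simp only [forLoop_wilsonIteration_cons i l]
  conv_lhs => rw [G.randomWalk_of_notMem hi, RandProg.bind_assoc]
  simp only [returnProb, Finset.sum_mul]
  rw [Finset.sum_comm, ← Finset.sum_add_distrib, RandProg.bind_apply]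
  refine Finset.sum_congr rfl fun v _ => ?_
  rw [G.randomWalk_split (Finset.subset_insert i V), RandProg.bind_assoc, randomWalk_insert_bind,
    bind_randomWalk_insert_eq_forLoop hi hτ (by simp), mul_add, Finset.mul_sum]
  simp only [mul_assoc]

/-- A maximum principle for the linear system `f = b + K f`. -/
theorem mul_eq_of_eq_add_sum_mul {ι : Type*} [Fintype ι] {X : ι → Prop} {K : ι → ι → ℝ≥0∞}
    {f : ι → ℝ≥0∞} {b c : ℝ≥0∞} (hX : ∀ i j, X i → K i j ≠ 0 → X j)
    (hK : ∀ i, X i → ∑ j, K i j + c = 1) (hf : ∀ i, f i ≠ ⊤)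
    (h : ∀ i, X i → f i = b + ∑ j, K i j * f j) {i : ι} (hi : X i) : f i * c = b := by
  classical
  have htop : ∀ i, X i → ∀ j, ∑ k, K i k * f j ≠ ⊤ := by
    intro i hi j
    rw [← Finset.sum_mul]
    exact ENNReal.mul_ne_top (ne_top_of_le_ne_top ENNReal.one_ne_top (hK i hi ▸ le_self_add)) (hf j)
  have hne : (Finset.univ.filter X).Nonempty := ⟨i, by simpa using hi⟩
  -- At a maximum point `p`, comparing this splitting with `f p = b + ∑ K f ≤ b + ∑ K (f p)` and
  -- cancelling the finite sum gives `f p * c ≤ b`. A minimum point gives the reverse, and `c` is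
  -- the same for all indices.
  have hsplit : ∀ j, X j → f j = f j * c + ∑ k, K j k * f j := by
    intro j hj
    rw [← Finset.sum_mul, mul_comm (∑ k, K j k), ← mul_add, add_comm, hK j hj, mul_one]
  obtain ⟨p, hp, hpmax⟩ := Finset.exists_max_image _ f hne
  obtain ⟨q, hq, hqmin⟩ := Finset.exists_min_image _ f hne
  simp only [Finset.mem_filter, Finset.mem_univ, true_and] at hp hpmax hq hqmin
  refine le_antisymm ?_ ?_
  · refine (mul_le_mul' (hpmax i hi) le_rfl).trans ?_
    refine (ENNReal.add_le_add_iff_right (htop p hp p)).1 ?_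
    rw [← hsplit p hp]
    conv_lhs => rw [h p hp]
    refine add_le_add le_rfl (Finset.sum_le_sum fun j _ => ?_)
    by_cases hj : K p j = 0
    · simp [hj]
    · exact mul_le_mul' le_rfl <| hpmax j (hX p j hp hj)
  · refine le_trans ?_ (mul_le_mul' (hqmin i hi) le_rfl)
    refine (ENNReal.add_le_add_iff_right (htop q hq q)).1 ?_
    rw [← hsplit q hq]
    conv_rhs => rw [h q hq]
    refine add_le_add le_rfl (Finset.sum_le_sum fun j _ => ?_)
    by_cases hj : K q j = 0
    · simp [hj]
    · exact mul_le_mul' le_rfl (hqmin j (hX q j hq hj))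

/-- Started with the roots `V`, Wilson's algorithm returns each forest with roots in `V` with
probability proportional to its weight. -/
theorem IsRooted.forLoop_apply (hG : G.IsRooted) (h0 : 0 ∈ V) (l : List (Fin (n + 1)))
    (hl : ∀ u ∉ V, u ∈ l) (hτ : τ ∈ forests V t) :
    RandProg.forLoop G.wilsonIteration l (V, t) (Finset.univ, τ) =
      G.pointerWeight V τ / G.forestSum V := by
  -- The inner induction on the list skips visited words. The list must stay arbitrary, since the
  -- outer hypothesis is used for `v :: l` with `v` the sampled parent of `i`.
  induction hk : Vᶜ.card using Nat.strong_induction_on generalizing V l t τ with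
  | _ k IH =>
  induction l with
  | nil =>
    have hV : V = Finset.univ := Finset.eq_univ_of_forall fun u => by
      by_contra hu
      simpa using hl u hu
    subst hV
    have hfor : forests Finset.univ t = {t} := by
      ext τ
      rw [mem_forests, Finset.mem_singleton]
      exact ⟨fun h => funext fun u => h.1 u (Finset.mem_univ u), fun h =>
        ⟨fun u _ => by rw [h], fun u => ⟨u, Finset.mem_univ u, .refl⟩⟩⟩
    have hw : G.pointerWeight Finset.univ τ = 1 := by simp [pointerWeight]
    have hw' : G.forestSum Finset.univ = 1 := by
      rw [← sum_forests t, hfor]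
      simp [pointerWeight]
    obtain rfl : τ = t := by simpa [hfor] using hτ
    rw [hw, hw', RandProg.forLoop, RandProg.ret_apply, if_pos rfl, div_one]
  | cons i l ihl =>
    by_cases hi : i ∈ V
    · rw [RandProg.forLoop, wilsonIteration_of_mem hi, RandProg.ret_bind]
      refine ihl fun u hu => ?_
      rcases List.mem_cons.1 (hl u hu) with rfl | h
      · exact absurd hi hu
      · exact h
    -- This is the term `b`. Once `i` is a root its pointer is never overwritten, so only `v = τ' i`
    -- contributes; the value does not depend on `t₁`.
    · have hfirst : ∀ t₁ τ', (∀ u ∈ V, t₁ u = t u) → τ' ∈ forests V t →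
          ∑ v, G.sampleParent i v * RandProg.forLoop G.wilsonIteration (v :: l)
            (insert i V, Function.update t₁ i (some v)) (Finset.univ, τ') =
          G.pointerWeight V τ' / G.forestSum (insert i V) := by
        intro t₁ τ' ht₁ hτ'
        obtain ⟨h1, h2⟩ := mem_forests.1 hτ'
        obtain ⟨v, hv⟩ := h2.exists_eq_some hi
        rw [Finset.sum_eq_single v]
        · rw [IH (insert i V)ᶜ.card ?_ (Finset.mem_insert_of_mem h0) _ ?_ ?_ rfl,
            pointerWeight_eq_mul hi hv, mul_div_assoc]
          · rw [← hk]
            refine Finset.card_lt_card (Finset.compl_ssubset_compl.2 (Finset.ssubset_insert hi))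
          · intro u hu
            rw [Finset.mem_insert, not_or] at hu
            rcases List.mem_cons.1 (hl u hu.2) with h | h
            · exact absurd h hu.1
            · exact List.mem_cons_of_mem v h
          · refine mem_forests.2 ⟨fun u hu => ?_,
              h2.mono (Finset.subset_insert i V) fun _ _ => rfl⟩
            by_cases hui : u = i
            · subst hui
              simp [hv]
            · rw [Function.update_of_ne hui]
              have huV : u ∈ V := by simpa [hui] using hu
              rw [h1 u huV, ht₁ u huV]
        · intro w _ hw
          by_contra h
          have h3 := (mem_forests.1 (mem_forests_of_forLoop_ne_zero (right_ne_zero_of_mul h))).1 i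
            (Finset.mem_insert_self i V)
          rw [hv, Function.update_self] at h3
          exact hw (Option.some.inj h3).symm
        · simp
      have hsum : ∀ t₁, (∀ u ∈ V, t₁ u = t u) → ∑ τ' ∈ forests V t,
          RandProg.forLoop G.wilsonIteration (i :: l) (V, t₁) (Finset.univ, τ') = 1 := by
        intro t₁ ht₁
        rw [← forests_congr ht₁]
        exact hG.sum_forLoop_forests h0 hl
      have htrans : ∀ t₁ t₂, (∀ u ∈ V, t₁ u = t u) → G.returnProb V i t₁ t₂ ≠ 0 →
          ∀ u ∈ V, t₂ u = t u := fun t₁ t₂ ht₁ h u hu =>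
        (agree_of_returnProb_ne_zero hi h u hu).trans (ht₁ u hu)
      -- Summing the renewal equation over all forests identifies the probability of escaping from
      -- `i` to `V` without return, with no knowledge of the law of the table at return.
      have hret : ∀ t₁, (∀ u ∈ V, t₁ u = t u) → ∑ t₂, G.returnProb V i t₁ t₂ +
          G.forestSum V / G.forestSum (insert i V) = 1 := by
        intro t₁ ht₁
        rw [← hsum t₁ ht₁, Finset.sum_congr rfl fun τ' hτ' =>
          (forLoop_cons_eq_add hi (mem_forests.1 hτ').2 t₁ l).trans
            (congrArg (· + _) (hfirst t₁ τ' ht₁ hτ')), Finset.sum_add_distrib, Finset.sum_comm,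
          add_comm]
        congr 1
        · rw [← sum_forests t]
          simp only [div_eq_mul_inv, Finset.sum_mul]
        · refine Finset.sum_congr rfl fun t₂ _ => ?_
          by_cases h : G.returnProb V i t₁ t₂ = 0
          · simp [h]
          · rw [← Finset.mul_sum, hsum t₂ (htrans t₁ t₂ ht₁ h), mul_one]
      have key := mul_eq_of_eq_add_sum_mul (X := fun t₁ : Pointers n => ∀ u ∈ V, t₁ u = t u)
        (f := fun t₁ => RandProg.forLoop G.wilsonIteration (i :: l) (V, t₁) (Finset.univ, τ))
        htrans hret ?_ (fun t₁ ht₁ => (forLoop_cons_eq_add hi (mem_forests.1 hτ).2 t₁ l).trans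
            (congrArg (· + _) (hfirst t₁ τ ht₁ hτ))) (i := t) (fun _ _ => rfl)
      · have hZ := hG.forestSum_ne_zero h0
        have hZ' := hG.forestSum_ne_zero (Finset.mem_insert_of_mem (b := i) h0)
        rw [ENNReal.eq_div_iff hZ forestSum_ne_top, mul_comm]
        rw [← mul_div_assoc] at key
        have := congrArg (· * G.forestSum (insert i V)) key
        simpa only [ENNReal.div_mul_cancel hZ' forestSum_ne_top] using this
      · intro t₁
        refine ne_top_of_le_ne_top ENNReal.one_ne_top ?_
        rw [← hG.sum_forLoop (i :: l) (V, t₁) h0]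
        exact Finset.single_le_sum (fun _ _ => zero_le) (Finset.mem_univ _)

end DependencyGraph

namespace DependencyGraph

variable {n : ℕ} {τ : Pointers n} {T : EdgeSet n} {G : DependencyGraph n}

/-! ### Spanning trees as pointer tables -/

theorem mem_edgesOf {v u : Fin (n + 1)} : (v, u) ∈ edgesOf τ ↔ τ u = some v := by
  simp [edgesOf]

theorem edgesOf_injective : Function.Injective (edgesOf : Pointers n → EdgeSet n) := by
  intro τ τ' h
  funext u
  refine Option.ext fun v => ?_
  rw [← mem_edgesOf, h, mem_edgesOf]

theorem isSpanningTree_edgesOf (hτ : τ ∈ forests {0} fun _ => none) :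
    IsSpanningTree (edgesOf τ) := by
  obtain ⟨h0, hr⟩ := mem_forests.1 hτ
  have hne : ∀ {v u}, τ u = some v → u ∉ ({0} : Finset (Fin (n + 1))) := by
    intro v u h hu
    rw [h0 u hu] at h
    simp at h
  -- Edges run from parent to child and pointers from child to parent, so paths are reversed.
  have hleads : ∀ {a b}, Relation.TransGen (fun a b => (a, b) ∈ edgesOf τ) a b →
      ∃ z, τ b = some z ∧ Leads {0} τ z a := by
    intro a b hab
    induction hab with
    | single h => exact ⟨_, mem_edgesOf.1 h, .refl⟩
    | tail _ h ih =>
      obtain ⟨z, hz, hza⟩ := ih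
      exact ⟨_, mem_edgesOf.1 h, .head ⟨hne hz, hz⟩ hza⟩
  have hacyc : ∀ v, ¬ Relation.TransGen (fun a b => (a, b) ∈ edgesOf τ) v v := by
    intro v hv
    obtain ⟨z, hz, hzv⟩ := hleads hv
    exact hr.not_leads (hne hz) hz hzv
  refine ⟨?_, ?_, hacyc⟩
  · rintro ⟨v, u⟩ he
    refine ⟨by simpa using hne (mem_edgesOf.1 he), fun h => ?_⟩
    obtain rfl : v = u := h
    exact hacyc v (.single he)
  · intro u hu
    obtain ⟨v, hv⟩ := hr.exists_eq_some (u := u) (by simpa using hu)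
    refine ⟨v, mem_edgesOf.2 hv, fun w hw => ?_⟩
    exact Option.some.inj ((mem_edgesOf.1 hw).symm.trans hv)

theorem exists_edgesOf_eq (hT : IsSpanningTree T) :
    ∃ τ ∈ forests {0} fun _ => none, edgesOf τ = T := by
  classical
  obtain ⟨h1, h2, h3⟩ := hT
  let τ : Pointers n := fun u => if h : ∃ v, (v, u) ∈ T then some h.choose else none
  have hτ : ∀ v u, τ u = some v ↔ (v, u) ∈ T := by
    intro v u
    constructor
    · intro h
      by_cases hu : ∃ v, (v, u) ∈ T
      · simp only [τ, dif_pos hu] at h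
        exact Option.some.inj h ▸ hu.choose_spec
      · simp only [τ, dif_neg hu] at h
        exact absurd h (by simp)
    · intro h
      have hu : ∃ v, (v, u) ∈ T := ⟨v, h⟩
      simp only [τ, dif_pos hu]
      exact congrArg some ((h2 u (h1 _ h).1).unique hu.choose_spec h)
  refine ⟨τ, mem_forests.2 ⟨fun u hu => ?_, ?_⟩, ?_⟩
  · obtain rfl : u = 0 := by simpa using hu
    rw [Option.eq_none_iff_forall_ne_some]
    intro v hv
    exact (h1 _ ((hτ v 0).1 hv)).1 rfl
  -- Acyclicity on a finite set makes ancestry well-founded, so climbing to parents ends at ROOT.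
  · have : Std.Irrefl (Relation.TransGen fun a b => (a, b) ∈ T) := ⟨h3⟩
    have hwf := Finite.wellFounded_of_trans_of_irrefl (Relation.TransGen fun a b => (a, b) ∈ T)
    intro u
    refine ⟨0, by simp, ?_⟩
    induction u using hwf.induction with
    | _ u ih =>
      by_cases hu : u = 0
      · rw [hu]
      · obtain ⟨v, hv, -⟩ := h2 u hu
        exact .head ⟨by simpa using hu, (hτ v u).2 hv⟩ (ih v (.single hv))
  · ext ⟨v, u⟩
    rw [mem_edgesOf, hτ]

theorem isRooted_of_treeWeight_ne_zero (hT : IsSpanningTree T) (hw : G.treeWeight T ≠ 0) :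
    G.IsRooted := by
  obtain ⟨τ, hτ, rfl⟩ := exists_edgesOf_eq hT
  refine ⟨τ, (mem_forests.1 hτ).2, fun u _ v hv => ?_⟩
  have h1 : G.W v u ≠ 0 := Finset.prod_ne_zero_iff.1 hw (v, u) (mem_edgesOf.2 hv)
  have h2 : 0 < G.W v u := lt_of_le_of_ne (G.nonneg v u) h1.symm
  have h3 : 0 < ∑ v', G.W v' u :=
    h2.trans_le (Finset.single_le_sum (fun v _ => G.nonneg v u) (Finset.mem_univ v))
  exact (ENNReal.ofReal_pos.2 (div_pos h2 h3)).ne'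

theorem isRooted_of_depPartition_pos (hZ : 0 < G.depPartition) : G.IsRooted := by
  classical
  obtain ⟨T, hT, hw⟩ := Finset.exists_ne_zero_of_sum_ne_zero hZ.ne'
  exact isRooted_of_treeWeight_ne_zero (Finset.mem_filter.1 hT).2.1 hw

theorem treeWeight_nonneg (T : EdgeSet n) : 0 ≤ G.treeWeight T :=
  Finset.prod_nonneg fun e _ => G.nonneg e.1 e.2

theorem ofReal_treeWeight_edgesOf (hτ : τ ∈ forests {0} fun _ => none) :
    ENNReal.ofReal (G.treeWeight (edgesOf τ)) =
      ∏ u ∈ {0}ᶜ, (τ u).elim 0 fun v => ENNReal.ofReal (G.W v u) := by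
  rw [treeWeight, ENNReal.ofReal_prod_of_nonneg fun e _ => G.nonneg e.1 e.2]
  refine Finset.prod_bij (fun e _ => e.2) ?_ ?_ ?_ ?_
  · rintro ⟨v, u⟩ he
    simpa using ((isSpanningTree_edgesOf hτ).1 _ he).1
  · rintro ⟨v, u⟩ he ⟨v', u'⟩ he' h
    obtain rfl : u = u' := h
    rw [mem_edgesOf] at he he'
    rw [Option.some.inj (he.symm.trans he')]
  · intro u hu
    obtain ⟨v, hv⟩ := (mem_forests.1 hτ).2.exists_eq_some (Finset.mem_compl.1 hu)
    exact ⟨(v, u), mem_edgesOf.2 hv, rfl⟩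
  · rintro ⟨v, u⟩ he
    rw [mem_edgesOf] at he
    simp [he]

/-- The product over all words of the total weights of the edges into them. -/
noncomputable def columnProduct (G : DependencyGraph n) : ℝ≥0∞ :=
  ∏ u ∈ ({0}ᶜ : Finset (Fin (n + 1))), ENNReal.ofReal (∑ v, G.W v u)

/-- Each word contributes one edge weight divided by its column sum; the product of the column sums
is common to all trees. -/
theorem IsRooted.pointerWeight_eq (hG : G.IsRooted) (hτ : τ ∈ forests {0} fun _ => none) :
    G.pointerWeight {0} τ =
      ENNReal.ofReal (G.treeWeight (edgesOf τ)) / G.columnProduct := by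
  have hpos : ∀ u ∈ ({0}ᶜ : Finset (Fin (n + 1))), 0 < ∑ v, G.W v u := by
    intro u hu
    refine lt_of_le_of_ne (Finset.sum_nonneg fun v _ => G.nonneg v u) fun h => ?_
    have h1 := hG.sum_sampleParent (u := u) (by simpa using hu)
    simp [G.sum_sampleParent u, ← h] at h1
  rw [ofReal_treeWeight_edgesOf hτ, columnProduct, div_eq_mul_inv,
    ENNReal.prod_inv_distrib, ← Finset.prod_mul_distrib, pointerWeight]
  · refine Finset.prod_congr rfl fun u hu => ?_
    obtain ⟨v, hv⟩ := (mem_forests.1 hτ).2.exists_eq_some (Finset.mem_compl.1 hu)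
    simp only [hv, Option.elim]
    rw [sampleParent, ENNReal.ofReal_div_of_pos (hpos u hu), div_eq_mul_inv]
  · intro u hu w hw _
    exact Or.inl (ENNReal.ofReal_pos.2 (hpos u hu)).ne'

/-! ### The law of Wilson's algorithm -/

theorem exists_of_wilson_ne_zero (h : G.wilson T ≠ 0) :
    ∃ τ ∈ forests {0} fun _ => none, edgesOf τ = T := by
  obtain ⟨⟨V, τ⟩, hs, h⟩ := RandProg.exists_of_bind_ne_zero h
  obtain ⟨h1, h2⟩ := forLoop_wilsonIteration_support hs
  obtain rfl : V = Finset.univ := by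
    refine Finset.eq_univ_of_forall fun u => ?_
    rcases Fin.eq_zero_or_eq_succ u with rfl | ⟨j, rfl⟩
    · exact h1.subset (Finset.mem_singleton_self 0)
    · exact h2 _ (List.mem_map_of_mem (List.mem_finRange j))
  exact ⟨τ, mem_forests_of_forLoop_ne_zero hs, (RandProg.eq_of_ret_ne_zero h).symm⟩

theorem IsRooted.sum_wilson (hG : G.IsRooted) : ∑ T, G.wilson T = 1 := by
  rw [wilson]
  exact RandProg.sum_bind_eq_one (hG.sum_forLoop _ _ (Finset.mem_singleton_self 0))
    fun _ _ => RandProg.sum_ret _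

theorem wilson_eq_zero (hT : ¬ IsSpanningTree T) : G.wilson T = 0 := by
  by_contra h
  obtain ⟨τ, hτ, rfl⟩ := exists_of_wilson_ne_zero h
  exact hT (isSpanningTree_edgesOf hτ)

theorem IsRooted.wilson_edgesOf (hG : G.IsRooted) (hτ : τ ∈ forests {0} fun _ => none) :
    G.wilson (edgesOf τ) = G.pointerWeight {0} τ / G.forestSum {0} := by
  have hl : ∀ u ∉ ({0} : Finset (Fin (n + 1))), u ∈ (List.finRange n).map Fin.succ := by
    intro u hu
    obtain ⟨j, rfl⟩ := Fin.exists_succ_eq.2 (by simpa using hu)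
    exact List.mem_map_of_mem (List.mem_finRange j)
  rw [← hG.forLoop_apply (Finset.mem_singleton_self 0) _ hl hτ, wilson, RandProg.bind_apply,
    Finset.sum_eq_single (Finset.univ, τ)]
  · rw [RandProg.ret_apply, if_pos rfl, mul_one]
  · rintro ⟨V, τ'⟩ _ hne
    by_contra h
    obtain ⟨h1, h2⟩ := forLoop_wilsonIteration_support (left_ne_zero_of_mul h)
    have h3 := RandProg.eq_of_ret_ne_zero (right_ne_zero_of_mul h)
    refine hne (Prod.ext (Finset.eq_univ_of_forall fun u => ?_) (edgesOf_injective h3.symm))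
    by_cases hu : u ∈ ({0} : Finset (Fin (n + 1)))
    · exact h1.subset hu
    · exact h2 u (hl u hu)
  · simp

/-- Wilson's algorithm returns each spanning tree with probability proportional to its weight. -/
theorem IsRooted.wilson_apply (hG : G.IsRooted) (hT : IsSpanningTree T) :
    G.wilson T = ENNReal.ofReal (G.treeWeight T) * (G.columnProduct⁻¹ * (G.forestSum {0})⁻¹) := by
  obtain ⟨τ, hτ, rfl⟩ := exists_edgesOf_eq hT
  rw [hG.wilson_edgesOf hτ, hG.pointerWeight_eq hτ, div_eq_mul_inv, div_eq_mul_inv, mul_assoc]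

/-! ### Rejection -/

/-- After a rejected first draw, the remaining loop has the law of a fresh call. -/
theorem wilsonReject_eq_add (T : EdgeSet n) [DecidablePred (HasSingleRootEdge (n := n))] :
    G.wilsonReject T = (if HasSingleRootEdge T then G.wilson T else 0) +
      (∑ T' with ¬ HasSingleRootEdge T', G.wilson T') * G.wilsonReject T := by
  conv_lhs => rw [wilsonReject, RandProg.bind_apply]
  rw [← Finset.sum_filter_add_sum_filter_not _ (HasSingleRootEdge (n := n))]
  refine Eq.trans ?_ (congrArg (_ + ·) (Finset.sum_mul _ _ _).symm)
  congr 1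
  · have h1 : ∀ T' ∈ Finset.univ.filter (HasSingleRootEdge (n := n)),
        G.wilson T' * RandProg.whileLoop (fun t => ¬ HasSingleRootEdge t)
          (fun _ => G.wilson) T' T = if T = T' then G.wilson T' else 0 := by
      intro T' hT'
      rw [RandProg.whileLoop_of_not (c := fun t => ¬ HasSingleRootEdge t) _
        (not_not.2 (Finset.mem_filter.1 hT').2), RandProg.ret_apply]
      simp
    refine (Finset.sum_congr rfl h1).trans ((Finset.sum_ite_eq _ T _).trans ?_)
    simp only [Finset.mem_filter, Finset.mem_univ, true_and]
  · refine Finset.sum_congr rfl fun T' hT' => ?_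
    rw [RandProg.whileLoop_of_cond (c := fun t => ¬ HasSingleRootEdge t) _
      (Finset.mem_filter.1 hT').2]
    rfl

theorem sum_wilson_hasSingleRootEdge [DecidablePred (IsDependencyTree (n := n))]
    [DecidablePred (HasSingleRootEdge (n := n))] :
    ∑ T with HasSingleRootEdge T, G.wilson T = ∑ T with IsDependencyTree T, G.wilson T := by
  symm
  refine Finset.sum_subset (fun T hT => ?_) fun T hT hT' => wilson_eq_zero fun h => hT' ?_
  · simpa using (Finset.mem_filter.1 hT).2.2
  · exact Finset.mem_filter.2 ⟨Finset.mem_univ T, h, (Finset.mem_filter.1 hT).2⟩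

theorem wilsonReject_apply (hZ : 0 < G.depPartition) (T : EdgeSet n) :
    G.wilsonReject T = ENNReal.ofReal (G.depProb T) := by
  classical
  have hG := isRooted_of_depPartition_pos hZ
  -- The normalizing constant is never evaluated. It is finite and nonzero because Wilson's
  -- algorithm has total mass 1, and so it cancels.
  set c := G.columnProduct⁻¹ * (G.forestSum {0})⁻¹ with hc
  have hZ' : ENNReal.ofReal G.depPartition =
      ∑ T with IsDependencyTree T, ENNReal.ofReal (G.treeWeight T) := by
    rw [depPartition, ENNReal.ofReal_sum_of_nonneg fun T _ => treeWeight_nonneg T]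
  have hq : ∑ T with HasSingleRootEdge T, G.wilson T = ENNReal.ofReal G.depPartition * c := by
    rw [sum_wilson_hasSingleRootEdge, hZ', Finset.sum_mul]
    exact Finset.sum_congr rfl fun T hT => hG.wilson_apply (Finset.mem_filter.1 hT).2.1
  have hone : ENNReal.ofReal G.depPartition * c +
      ∑ T with ¬ HasSingleRootEdge T, G.wilson T = 1 := by
    rw [← hq, ← hG.sum_wilson]
    exact Finset.sum_filter_add_sum_filter_not _ _ _
  have hZ0 : ENNReal.ofReal G.depPartition ≠ 0 := (ENNReal.ofReal_pos.2 hZ).ne'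
  have hctop : c ≠ ⊤ := by
    intro h
    rw [h, ENNReal.mul_top hZ0, top_add] at hone
    exact ENNReal.top_ne_one hone
  have hc0 : c ≠ 0 := by
    intro h0
    have hw : ∀ T, G.wilson T = 0 := fun T => by
      by_cases hT : IsSpanningTree T
      · rw [hG.wilson_apply hT, ← hc, h0, mul_zero]
      · exact wilson_eq_zero hT
    have := hG.sum_wilson
    simp [hw] at this
  have hle : ∑ T, G.wilsonReject T ≤ 1 := by
    rw [wilsonReject, RandProg.sum_bind, ← hG.sum_wilson]
    exact Finset.sum_le_sum fun T' _ => mul_le_of_le_one_right' <|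
      RandProg.sum_whileLoop_le_one (fun _ => hG.sum_wilson.le) T'
  have hfin : G.wilsonReject T ≠ ⊤ := ne_top_of_le_ne_top ENNReal.one_ne_top
    ((Finset.single_le_sum (fun _ _ => zero_le) (Finset.mem_univ T)).trans hle)
  have hq0 : ∑ T with ¬ HasSingleRootEdge T, G.wilson T ≠ ⊤ :=
    ne_top_of_le_ne_top ENNReal.one_ne_top (hone ▸ le_add_self)
  -- The factor `ENNReal.ofReal G.depPartition * c` is the acceptance probability. Adding the finite
  -- rejection term to both sides replaces a subtraction in `ℝ≥0∞`.
  have key : ENNReal.ofReal G.depPartition * c * G.wilsonReject T =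
      if HasSingleRootEdge T then G.wilson T else 0 := by
    refine (ENNReal.add_left_inj (ENNReal.mul_ne_top hq0 hfin)).1 ?_
    rw [← add_mul, hone, one_mul]
    exact wilsonReject_eq_add T
  have hw : (if HasSingleRootEdge T then G.wilson T else 0) =
      ENNReal.ofReal G.depPartition * c * ENNReal.ofReal (G.depProb T) := by
    by_cases hT : IsDependencyTree T
    · rw [if_pos hT.2, hG.wilson_apply hT.1, depProb, if_pos hT, ← hc,
        mul_right_comm, ← ENNReal.ofReal_mul hZ.le, mul_div_cancel₀ _ hZ.ne']
    · rw [depProb, if_neg hT, ENNReal.ofReal_zero, mul_zero]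
      split_ifs with h
      · exact wilson_eq_zero fun h' => hT ⟨h', h⟩
      · rfl
  exact (ENNReal.mul_right_inj (mul_ne_zero hZ0 hc0)
    (ENNReal.mul_ne_top ENNReal.ofReal_ne_top hctop)).1 (key.trans hw)

/-! ### The target distribution and the conclusion. -/

theorem sum_depProb (hZ : 0 < G.depPartition) : ∑ T, G.depProb T = 1 := by
  classical
  rw [← div_self hZ.ne']
  conv_rhs => arg 1; rw [depPartition]
  rw [Finset.sum_div, Finset.sum_filter]
  simp only [depProb]

theorem depProb_nonneg (hZ : 0 < G.depPartition) (T : EdgeSet n) : 0 ≤ G.depProb T := by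
  unfold depProb
  split_ifs
  · exact div_nonneg (treeWeight_nonneg T) hZ.le
  · exact le_rfl

end DependencyGraph

open DependencyGraph in
/-- WilsonReject is unbiased: on every dependency graph with `Z_D > 0` it halts with probability
`1`, it returns each dependency tree `t` with probability `φ(t) / Z_D` and nothing else, and
repeated calls return independent trees with this distribution. -/
theorem mainTheorem2 (n : ℕ) (G : DependencyGraph n) (hZ : 0 < G.depPartition) :
    (∑ t : EdgeSet n, G.wilsonReject t = 1) ∧
    (∀ t : EdgeSet n, IsDependencyTree t →
      G.wilsonReject t = ENNReal.ofReal (G.treeWeight t / G.depPartition)) ∧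
    (∀ t : EdgeSet n, ¬ IsDependencyTree t → G.wilsonReject t = 0) ∧
    (∀ (k : ℕ) (ts : Fin k → EdgeSet n),
      RandProg.draws G.wilsonReject k ts = ∏ i, ENNReal.ofReal (G.depProb (ts i))) := by
  refine ⟨?_, fun t ht => ?_, fun t ht => ?_, fun k ts => ?_⟩
  · rw [Finset.sum_congr rfl fun t _ => wilsonReject_apply hZ t,
      ← ENNReal.ofReal_sum_of_nonneg fun t _ => depProb_nonneg hZ t, sum_depProb hZ,
      ENNReal.ofReal_one]
  · rw [wilsonReject_apply hZ, depProb, if_pos ht]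
  · rw [wilsonReject_apply hZ, depProb, if_neg ht, ENNReal.ofReal_zero]
  · rw [RandProg.draws_apply]
    exact Finset.prod_congr rfl fun i _ => wilsonReject_apply hZ (ts i)
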